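/- Let $\ell,m,n$ be positive integers, let $N$ be a nonempty $n$-dimensional $C^\infty$ manifold without boundary (Hausdorff, second countable), let $U\subset\mathbb{R}^m$ be open, let $f:N\to U$ be an injective $C^\infty$ mapping and let $F:U\to\mathbb{R}^\ell$ be a $C^\infty$ mapping. For a linear mapping $\pi:\mathbb{R}^m\to\mathbb{R}^\ell$ put $F_\pi=F+\pi|_U:U\to\mathbb{R}^\ell$, and let $\mathcal{L}(\mathbb{R}^m,\mathbb{R}^\ell)$, the space of all such $\pi$, be identified with $(\mathbb{R}^m)^\ell$ through representing matrices. For a positive integer $s$ let $N^{(s)}=\{(q_1,\dots,q_s)\in N^s\mid q_i\neq q_j\ (i\neq j)\}$, an open submanifold of $N^s$; for $g:N\to\mathbb{R}^\ell$ let $g^{(s)}:N^{(s)}\to(\mathbb{R}^\ell)^s$ be the mapping $(q_1,\dots,q_s)\mapsto(g(q_1),\dots,g(q_s))$; and let $\Delta_s=\{(y,\dots,y)\mid y\in\mathbb{R}^\ell\}\subset(\mathbb{R}^\ell)^s$. A $C^\infty$ mapping $h:M\to P$ of manifolds is transverse to a submanifold $W\subset P$ if $dh_q(T_qM)+T_{h(q)}W=T_{h(q)}P$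 for every $q\in M$ with $h(q)\in W$. A $C^\infty$ mapping $g:N\to\mathbb{R}^\ell$ is a mapping with normal crossings if $g^{(s)}$ is transverse to $\Delta_s$ for every integer $s\ge 2$. Finally, set $$s_f=\max\Big\{s\ge 1\ \Big|\ \text{for all }(q_1,\dots,q_s)\in N^{(s)},\ \dim\sum_{i=2}^s\mathbb{R}\,\big(f(q_i)-f(q_1)\big)=s-1\Big\}.$$ Then there exists a subset $\Sigma\subset\mathcal{L}(\mathbb{R}^m,\mathbb{R}^\ell)$ of Lebesgue measure zero such that for every $\pi\in\mathcal{L}(\mathbb{R}^m,\mathbb{R}^\ell)\setminus\Sigma$ both of the following hold: 1. for every integer $s$ with $2\le s\le s_f$, the mapping $(F_\pi\circ f)^{(s)}:N^{(s)}\to(\mathbb{R}^\ell)^s$ is transverse to $\Delta_s$; 2. if $|F_\pi^{-1}(y)|\le s_f$ for every $y\in\mathbb{R}^\ell$, then $F_\pi\circ f:N\to\mathbb{R}^\ell$ is a mapping with normal crossings. -/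

import Mathlib

open Set Topology Manifold MeasureTheory
open scoped ContDiff

/-- The space `N^{(s)}` of `s`-tuples of pairwise distinct points, as an open subset of `N^s`. -/
def configSpace (N : Type*) [TopologicalSpace N] [T2Space N] (s : ℕ) :
    TopologicalSpace.Opens (Fin s → N) where
  carrier := {q | ∀ i j, i ≠ j → q i ≠ q j}
  is_open' := by
    simp only [ofPred_forall]
    refine isOpen_iInter_of_finite fun i => isOpen_iInter_of_finite fun j =>
      isOpen_iInter_of_finite fun _ => ?_
    exact isOpen_ne_fun (continuous_apply i) (continuous_apply j)

/-- The multi-map `g^{(s)} : N^{(s)} → P^s`, `(q_1, …, q_s) ↦ (g q_1, …, g q_s)`. -/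
def multiMap {N P : Type*} [TopologicalSpace N] [T2Space N] (g : N → P) (s : ℕ) :
    configSpace N s → (Fin s → P) :=
  fun q i => g (q.1 i)

/-- The diagonal `Δ_s = {(y, …, y) | y ∈ P}` of `P^s`. -/
def diagonalSet (P : Type*) (s : ℕ) : Set (Fin s → P) :=
  {z | ∃ y : P, z = fun _ => y}

/-- The tangent space at `w` of a submanifold `W` of a normed space: the span of the velocities
at time `0` of the smooth curves that pass through `w` at time `0` and stay in `W`. -/
def submanifoldTangent {E : Type*} [NormedAddCommGroup E] [NormedSpace ℝ E]
    (W : Set E) (w : E) : Submodule ℝ E :=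
  Submodule.span ℝ {v | ∃ γ : ℝ → E, ContDiffAt ℝ ∞ γ 0 ∧ γ 0 = w ∧
    (∀ᶠ t in 𝓝 (0 : ℝ), γ t ∈ W) ∧ deriv γ 0 = v}

/-- `g : M → E` is transverse to the submanifold `W` of the normed space `E`:
`dg_q (T_q M) + T_{g q} W = T_{g q} E` at every `q` with `g q ∈ W`. -/
def TransverseTo {E' H M E : Type*} [NormedAddCommGroup E'] [NormedSpace ℝ E']
    [TopologicalSpace H] (I : ModelWithCorners ℝ E' H) [TopologicalSpace M] [ChartedSpace H M]
    [NormedAddCommGroup E] [NormedSpace ℝ E] (g : M → E) (W : Set E) : Prop :=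
  ∀ q : M, g q ∈ W →
    (LinearMap.range (mfderiv I 𝓘(ℝ, E) g q).toLinearMap : Submodule ℝ E) ⊔
      submanifoldTangent W (g q) = ⊤

/-- The multi-map `g^{(s)} : N^{(s)} → (ℝ^ℓ)^s` is transverse to the diagonal `Δ_s`. Here
`N^{(s)}` is an open submanifold of the product manifold `N^s`. -/
def MultiTransverse {n ℓ : ℕ} {N : Type*} [TopologicalSpace N] [T2Space N]
    [ChartedSpace (EuclideanSpace ℝ (Fin n)) N] (g : N → EuclideanSpace ℝ (Fin ℓ)) (s : ℕ) : Prop :=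
  TransverseTo (ModelWithCorners.pi fun _ : Fin s => 𝓡 n) (multiMap g s)
    (diagonalSet (EuclideanSpace ℝ (Fin ℓ)) s)

/-- `g : N → ℝ^ℓ` is a mapping with normal crossings. -/
def NormalCrossings {n ℓ : ℕ} {N : Type*} [TopologicalSpace N] [T2Space N]
    [ChartedSpace (EuclideanSpace ℝ (Fin n)) N] (g : N → EuclideanSpace ℝ (Fin ℓ)) : Prop :=
  ∀ s : ℕ, 2 ≤ s → MultiTransverse (n := n) g s

/-- The positive integers `s` such that, for all pairwise distinct `q_1, …, q_s`, the vectors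
`f q_i - f q_1` with `2 ≤ i ≤ s` span a space of dimension `s - 1`. -/
def generalPositionSet {N V : Type*} [AddCommGroup V] [Module ℝ V] (f : N → V) : Set ℕ :=
  {s | ∃ hs : 0 < s, ∀ q : Fin s → N, (∀ i j, i ≠ j → q i ≠ q j) →
    Module.finrank ℝ (Submodule.span ℝ
      {v : V | ∃ i : Fin s, i ≠ ⟨0, hs⟩ ∧ v = f (q i) - f (q ⟨0, hs⟩)}) = s - 1}

/-- The number `s_f`, the largest element of `generalPositionSet f`. -/
noncomputable def generalPositionIndex {N V : Type*} [AddCommGroup V] [Module ℝ V]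
    (f : N → V) : ℕ :=
  sSup (generalPositionSet f)

/-- The supremum in `generalPositionIndex` is a maximum as soon as `N` is infinite, in particular
when `N` is a nonempty manifold of positive dimension. -/
theorem isGreatest_generalPositionIndex {N V : Type*} [Infinite N] [AddCommGroup V] [Module ℝ V]
    [FiniteDimensional ℝ V] (f : N → V) :
    IsGreatest (generalPositionSet f) (generalPositionIndex f) := by
  have hne : (generalPositionSet f).Nonempty := by
    refine ⟨1, one_pos, fun q _ => ?_⟩
    have : {v : V | ∃ i : Fin 1, i ≠ ⟨0, one_pos⟩ ∧ v = f (q i) - f (q ⟨0, one_pos⟩)} = ∅ := by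
      ext v
      simp only [mem_ofPred_eq, mem_empty_iff_false, iff_false, not_exists, not_and]
      exact fun i hi => (hi (Subsingleton.elim _ _)).elim
    rw [this]
    simp
  have hbd : BddAbove (generalPositionSet f) := by
    refine ⟨Module.finrank ℝ V + 1, ?_⟩
    rintro s ⟨hs, h⟩
    have h1 := h (fun i => Infinite.natEmbedding N i) fun i j hij hq =>
      hij (Fin.ext ((Infinite.natEmbedding N).injective hq))
    have h2 := Submodule.finrank_le (Submodule.span ℝ
      {v : V | ∃ i : Fin s, i ≠ ⟨0, hs⟩ ∧ v = f (Infinite.natEmbedding N i) -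
        f (Infinite.natEmbedding N (⟨0, hs⟩ : Fin s))})
    omega
  exact ⟨Nat.sSup_mem hne hbd, fun s hs => le_csSup hbd hs⟩

/-- The linear perturbation `F_π = F + π` on the open set `U`. -/
def linearPerturbation {m ℓ : ℕ} {U : TopologicalSpace.Opens (EuclideanSpace ℝ (Fin m))}
    (F : U → EuclideanSpace ℝ (Fin ℓ))
    (π : EuclideanSpace ℝ (Fin m) →ₗ[ℝ] EuclideanSpace ℝ (Fin ℓ)) :
    U → EuclideanSpace ℝ (Fin ℓ) :=
  fun x => F x + π x

/-- The representing matrix `(α_{ij})` of a linear mapping `ℝ^m → ℝ^ℓ`, as a point of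
`(ℝ^m)^ℓ`. -/
noncomputable def representingMatrix {m ℓ : ℕ}
    (π : EuclideanSpace ℝ (Fin m) →ₗ[ℝ] EuclideanSpace ℝ (Fin ℓ)) : Fin ℓ → Fin m → ℝ :=
  fun i j => π (EuclideanSpace.single j 1) i

/-- A set of linear mappings has Lebesgue measure zero, under the identification
`ℒ(ℝ^m, ℝ^ℓ) = (ℝ^m)^ℓ`. -/
def LebesgueNull {m ℓ : ℕ}
    (S : Set (EuclideanSpace ℝ (Fin m) →ₗ[ℝ] EuclideanSpace ℝ (Fin ℓ))) : Prop :=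
  volume (representingMatrix '' S) = 0

/-! A multi-map of `g` is transverse to the diagonal at a tuple it sends there as soon as the
differences of the differentials, `dg(v_i) - dg(v_1)`, fill `(ℝ^ℓ)^(s-1)`. In charts, for `g = F_π ∘
f`, this says that zero is a regular value of `u ↦ b u + A u π`, where `b` collects the differences
of `F ∘ f` and `A u` evaluates `π` on the vectors `f(q_i) - f(q_1)`. If `s ≤ s_f` these vectors are
linearly independent, so `A u` is surjective: varying `π` alone already moves the value in every
direction. The exceptional `π` are then critical values of a smooth map into the parameter space
(`addHaar_setOf_affine_not_transverse_eq_zero`), hence null by Sard's theorem, which is proved here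
by induction on the dimension of the source. Countably many chart tuples and values of `s` suffice.

For `s > s_f` the fibre bound keeps the multi-map off the diagonal altogether: since `f` is
injective, a tuple sent to the diagonal would give `s` distinct points in one fibre of `F_π`. -/

/-- A union of sets indexed by `s` is null as soon as it is so locally on `s`. -/
theorem measure_biUnion_null_of_locally_null {X Y : Type*} [TopologicalSpace X]
    [SecondCountableTopology X] [MeasurableSpace Y] (μ : Measure Y) {s : Set X} (P : X → Set Y)
    (h : ∀ x ∈ s, ∃ u ∈ 𝓝 x, μ (⋃ y ∈ s ∩ u, P y) = 0) : μ (⋃ x ∈ s, P x) = 0 := by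
  choose! u hu hμ using h
  obtain ⟨t, hts, htc, hst⟩ := TopologicalSpace.countable_cover_nhdsWithin
    (fun x hx => mem_nhdsWithin_of_mem_nhds (hu x hx))
  refine measure_mono_null ?_ ((measure_biUnion_null_iff htc).2 fun x hx => hμ x (hts hx))
  intro y hy
  simp only [mem_iUnion] at hy ⊢
  obtain ⟨x, hx, hy⟩ := hy
  obtain ⟨i, hi, hxi⟩ := mem_iUnion₂.1 (hst hx)
  exact ⟨i, hi, x, ⟨hx, hxi⟩, hy⟩

/-- The image of a set is null as soon as it is so locally. -/
theorem measure_image_null_of_locally_null {X Y : Type*} [TopologicalSpace X]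
    [SecondCountableTopology X] [MeasurableSpace Y] (μ : Measure Y) {s : Set X} (f : X → Y)
    (h : ∀ x ∈ s, ∃ u ∈ 𝓝 x, μ (f '' (s ∩ u)) = 0) : μ (f '' s) = 0 := by
  have := measure_biUnion_null_of_locally_null μ (s := s) (fun x => {f x})
    (by simpa only [← image_eq_iUnion] using h)
  simpa only [← image_eq_iUnion] using this

/-! ### Surjective linear maps and Haar null sets. -/

section LinearMaps

variable {E F : Type*} [NormedAddCommGroup E] [NormedSpace ℝ E] [NormedAddCommGroup F]
  [NormedSpace ℝ F] [FiniteDimensional ℝ F]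

/-- If `R` is a right inverse of `L`, then `L'.comp R` stays invertible for `L'` near `L`, which
forces `L'` to be surjective. -/
theorem isOpen_setOf_surjective_continuousLinearMap :
    IsOpen {L : E →L[ℝ] F | Function.Surjective L} := by
  have : CompleteSpace F := FiniteDimensional.complete ℝ F
  rw [isOpen_iff_mem_nhds]
  intro L hL
  obtain ⟨R, hR⟩ := L.exists_rightInverse_of_surjective (LinearMap.range_eq_top.2 hL)
  have ho : IsOpen {L' : E →L[ℝ] F | IsUnit (L'.comp R)} :=
    Units.isOpen.preimage ((ContinuousLinearMap.compL ℝ F E F).flip R).continuous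
  have hmem : L ∈ {L' : E →L[ℝ] F | IsUnit (L'.comp R)} := by
    simp only [mem_ofPred_eq, hR]
    exact isUnit_one
  filter_upwards [ho.mem_nhds hmem] with L' hL'
  obtain ⟨v, hv⟩ := hL'
  intro y
  refine ⟨R (v⁻¹.1 y), ?_⟩
  have : (v.1 * v⁻¹.1) y = y := by simp
  rw [hv] at this
  exact this

/-- Images of null sets under linear isomorphisms are null, for all Haar measures. -/
theorem addHaar_preimage_null_iff {F G : Type*} [NormedAddCommGroup F] [NormedSpace ℝ F]
    [NormedAddCommGroup G] [NormedSpace ℝ G] [FiniteDimensional ℝ G] [MeasurableSpace F] [BorelSpace F] [MeasurableSpace G]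
    [BorelSpace G] (μ : Measure F) [μ.IsAddHaarMeasure] (ν : Measure G) [ν.IsAddHaarMeasure]
    (e : F ≃L[ℝ] G) (s : Set G) : μ (e ⁻¹' s) = 0 ↔ ν s = 0 := by
  have h : μ (e ⁻¹' s) = (μ.map e) s :=
    (e.toHomeomorph.toMeasurableEquiv.map_apply s).symm
  rw [h]
  exact ⟨fun h => Measure.absolutelyContinuous_isAddHaarMeasure ν (μ.map e) h,
    fun h => Measure.absolutelyContinuous_isAddHaarMeasure (μ.map e) ν h⟩

end LinearMaps

/-! ### Taylor estimates and straightening coordinates. -/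

section Flat

universe u

/-- Taylor estimate at the points where the first `k` derivatives vanish, uniform on compact convex
sets. -/
theorem exists_norm_sub_le_of_iteratedFDeriv_eq_zero {E : Type u} [NormedAddCommGroup E]
    [NormedSpace ℝ E] {U K : Set E} (hU : IsOpen U) (hK : IsCompact K) (hKc : Convex ℝ K)
    (hKU : K ⊆ U) (k : ℕ) : ∀ {G : Type u} [NormedAddCommGroup G] [NormedSpace ℝ G] {f : E → G},
    ContDiffOn ℝ ∞ f U → ∃ M : ℝ, 0 ≤ M ∧ ∀ x ∈ K,
      (∀ j, 1 ≤ j → j ≤ k → iteratedFDeriv ℝ j f x = 0) →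
        ∀ y ∈ K, ‖f y - f x‖ ≤ M * ‖y - x‖ ^ (k + 1) := by
  induction k with
  | zero =>
    intro G _ _ f hf
    have hd : ContinuousOn (fderiv ℝ f) K :=
      (hf.continuousOn_fderiv_of_isOpen hU (by simp)).mono hKU
    obtain ⟨M, hM⟩ := hK.exists_bound_of_continuousOn hd
    refine ⟨max M 0, le_max_right _ _, fun x hx _ y hy => ?_⟩
    simpa using hKc.norm_image_sub_le_of_norm_fderiv_le (𝕜 := ℝ)
      (fun z hz => (hf.contDiffAt (hU.mem_nhds (hKU hz))).differentiableAt (by simp))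
      (fun z hz => (hM z hz).trans (le_max_left M 0)) hx hy
  | succ k ih =>
    intro G _ _ f hf
    have hf' : ContDiffOn ℝ ∞ (fderiv ℝ f) U := hf.fderiv_of_isOpen hU (by simp)
    -- The induction hypothesis is applied to the derivative, whose values lie in `E →L[ℝ] G`; this
    -- is why `G` is quantified inside the induction.
    obtain ⟨M, hM0, hM⟩ := ih hf'
    refine ⟨M, hM0, fun x hx hx0 y hy => ?_⟩
    have hfx : fderiv ℝ f x = 0 := by
      have h1 : ‖iteratedFDeriv ℝ 0 (fderiv ℝ f) x‖ = 0 := by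
        rw [norm_iteratedFDeriv_fderiv, hx0 1 le_rfl (by omega), norm_zero]
      simpa using h1
    have hfl : ∀ z ∈ K, ‖fderiv ℝ f z‖ ≤ M * ‖z - x‖ ^ (k + 1) := by
      intro z hz
      have := hM x hx (fun j h1 hj => ?_) z hz
      · simpa [hfx] using this
      · rw [← norm_eq_zero, norm_iteratedFDeriv_fderiv, hx0 (j + 1) (by omega) (by omega),
          norm_zero]
    have hseg : segment ℝ x y ⊆ K := hKc.segment_subset hx hy
    have := (convex_segment x y).norm_image_sub_le_of_norm_fderiv_le (𝕜 := ℝ) (f := f)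
      (C := M * ‖y - x‖ ^ (k + 1))
      (fun z hz => (hf.contDiffAt (hU.mem_nhds (hKU (hseg hz)))).differentiableAt (by simp))
      (fun z hz => (hfl z (hseg hz)).trans ?_) (left_mem_segment ℝ x y) (right_mem_segment ℝ x y)
    · rwa [mul_assoc, ← pow_succ] at this
    · gcongr
      rw [← dist_eq_norm, ← dist_eq_norm, dist_comm z, dist_comm y]
      obtain ⟨a, b, ha, hb, hab, rfl⟩ := hz
      have h2 : x - (a • x + b • y) = b • (x - y) := by
        have : a = 1 - b := by linarith
        subst this; module
      rw [dist_eq_norm, dist_eq_norm, h2, norm_smul, Real.norm_of_nonneg hb]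
      exact mul_le_of_le_one_left (norm_nonneg _) (by linarith)

/-- Near a point where `w` is not critical there are coordinates of which `w` is the first. -/
theorem exists_straightening {E : Type*} [NormedAddCommGroup E] [NormedSpace ℝ E]
    [FiniteDimensional ℝ E] {U : Set E} (hU : IsOpen U) {w : E → ℝ} (hw : ContDiffOn ℝ ∞ w U)
    {x : E} (hx : x ∈ U) (hdw : fderiv ℝ w x ≠ 0) :
    ∃ K : Submodule ℝ E, Module.finrank ℝ K < Module.finrank ℝ E ∧
      ∃ (Ω : Set (ℝ × K)) (φ : ℝ × K → E), IsOpen Ω ∧ ContDiffOn ℝ ∞ φ Ω ∧ MapsTo φ Ω U ∧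
        φ '' Ω ∈ 𝓝 x ∧ ∀ p ∈ Ω, w (φ p) = p.1 := by
  have : CompleteSpace E := FiniteDimensional.complete ℝ E
  set L := fderiv ℝ w x with hL
  have hLs : Function.Surjective L := LinearMap.surjective (f := L.toLinearMap) (by
    intro h; exact hdw (ContinuousLinearMap.coe_injective h))
  obtain ⟨R, hR⟩ := L.exists_rightInverse_of_surjective (LinearMap.range_eq_top.2 hLs)
  let e : E ≃L[ℝ] ℝ × L.ker := ContinuousLinearEquiv.equivOfRightInverse L R
    (fun t => congrArg (fun T : ℝ →L[ℝ] ℝ => T t) hR)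
  refine ⟨L.ker, Submodule.finrank_lt ?_, ?_⟩
  · intro h; exact hdw (ContinuousLinearMap.coe_injective (LinearMap.ker_eq_top.1 h))
  -- Replacing the first linear coordinate by `w` leaves the derivative at `x` equal to the
  -- isomorphism `e`, so the inverse function theorem applies.
  let h : E → ℝ × L.ker := fun y => (w y, (e y).2)
  have hh : ContDiffOn ℝ ∞ h U :=
    hw.prodMk (contDiff_snd.comp e.contDiff).contDiffOn
  have hwx : HasFDerivAt w L x :=
    ((hw.contDiffAt (hU.mem_nhds hx)).differentiableAt (by simp)).hasFDerivAt
  have hdx : HasFDerivAt h (e : E →L[ℝ] ℝ × L.ker) x :=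
    (hwx.prodMk ((hasFDerivAt_snd (𝕜 := ℝ)).comp x e.hasFDerivAt)).congr_fderiv (by
      ext y <;> rfl)
  let Φ := (hh.contDiffAt (hU.mem_nhds hx)).toOpenPartialHomeomorph h hdx (by simp)
  have hΦ : (Φ : E → ℝ × L.ker) = h := rfl
  have hxΦ : x ∈ Φ.source := ContDiffAt.mem_toOpenPartialHomeomorph_source _ hdx (by simp)
  -- Keeping only the points where the derivative of `h` is invertible makes the local inverse
  -- smooth on all of its domain.
  let V : Set E := U ∩ fderiv ℝ h ⁻¹' range ((↑) : (E ≃L[ℝ] ℝ × L.ker) → E →L[ℝ] ℝ × L.ker)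
  have hV : IsOpen V := (hh.continuousOn_fderiv_of_isOpen hU (by simp)).isOpen_inter_preimage hU
    ContinuousLinearEquiv.isOpen
  have hxV : x ∈ V := ⟨hx, e, hdx.fderiv.symm⟩
  refine ⟨Φ.target ∩ Φ.symm ⁻¹' V, Φ.symm, Φ.isOpen_inter_preimage_symm hV, ?_, ?_, ?_, ?_⟩
  · rintro p ⟨hp, hpU, e', he'⟩
    refine (Φ.contDiffAt_symm hp (f₀' := e') ?_ (hh.contDiffAt (hU.mem_nhds hpU))).contDiffWithinAt
    rw [he', hΦ]
    exact ((hh.contDiffAt (hU.mem_nhds hpU)).differentiableAt (by simp)).hasFDerivAt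
  · exact fun p hp => hp.2.1
  · filter_upwards [Φ.open_source.mem_nhds hxΦ, hV.mem_nhds hxV] with y hy hyV
    exact ⟨Φ y, ⟨Φ.map_source hy, by simpa [Φ.left_inv hy] using hyV⟩, Φ.left_inv hy⟩
  · intro p hp
    have := Φ.right_inv hp.1
    rw [hΦ] at this
    exact congrArg Prod.fst this

end Flat

/-! ### Sard's theorem. -/

section Sard

universe u

/-- Sard's theorem for the points where all derivatives up to the dimension vanish. -/
theorem addHaar_image_flat_eq_zero {E F : Type u} [NormedAddCommGroup E] [NormedSpace ℝ E]
    [FiniteDimensional ℝ E] [NormedAddCommGroup F] [NormedSpace ℝ F] [FiniteDimensional ℝ F]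
    [Nontrivial F] [MeasurableSpace F] [BorelSpace F] (μ : Measure F) [μ.IsAddHaarMeasure]
    {U : Set E} (hU : IsOpen U) {f : E → F} (hf : ContDiffOn ℝ ∞ f U) :
    μ (f '' {x | x ∈ U ∧ ∀ j, 1 ≤ j → j ≤ Module.finrank ℝ E → iteratedFDeriv ℝ j f x = 0}) = 0 := by
  refine measure_image_null_of_locally_null μ f fun x hx => ?_
  obtain ⟨r, hr, hrU⟩ := Metric.nhds_basis_closedBall.mem_iff.1 (hU.mem_nhds hx.1)
  refine ⟨Metric.closedBall x r, Metric.closedBall_mem_nhds x hr, ?_⟩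
  set n := Module.finrank ℝ E with hn
  obtain ⟨M, hM0, hM⟩ := exists_norm_sub_le_of_iteratedFDeriv_eq_zero hU
    (isCompact_closedBall x r) (convex_closedBall x r) hrU n hf
  lift M to NNReal using hM0
  set S := {x | x ∈ U ∧ ∀ j, 1 ≤ j → j ≤ n → iteratedFDeriv ℝ j f x = 0} ∩
    Metric.closedBall x r with hS
  -- Hölder exponent `n + 1` on a set of dimension at most `n` gives an image of dimension at most
  -- `n / (n + 1) < 1`.
  have hhol : HolderOnWith M (n + 1 : ℕ) f S := by
    intro a ha b hb
    have h := hM b hb.2 hb.1.2 a ha.2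
    rw [edist_dist, edist_dist, dist_eq_norm, dist_eq_norm, NNReal.coe_natCast,
      ENNReal.rpow_natCast, ← ENNReal.ofReal_pow (norm_nonneg _)]
    rw [← ENNReal.ofReal_coe_nnreal, ← ENNReal.ofReal_mul M.coe_nonneg]
    exact ENNReal.ofReal_le_ofReal h
  have hdim := hhol.dimH_image_le (by positivity)
  have hSd : dimH S ≤ n := (dimH_mono (subset_univ S)).trans_eq (Real.dimH_univ_eq_finrank E)
  have hp : 1 ≤ Module.finrank ℝ F := Module.finrank_pos
  have hlt : dimH (f '' S) < (Module.finrank ℝ F : NNReal) := by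
    refine hdim.trans_lt ((ENNReal.div_le_div_right hSd _).trans_lt ?_)
    refine lt_of_lt_of_le ?_ (show (1 : ENNReal) ≤ _ by exact_mod_cast hp)
    refine ENNReal.div_lt_of_lt_mul ?_
    rw [one_mul]
    exact_mod_cast Nat.lt_succ_self n
  have := hausdorffMeasure_of_dimH_lt hlt
  rw [NNReal.coe_natCast] at this
  exact Measure.absolutelyContinuous_isAddHaarMeasure μ _ this

/-- The inductive step in Sard's theorem at the critical points where some derivative of order at
least two is the first one not to vanish. -/
theorem addHaar_image_finite_order_eq_zero {E F : Type u} [NormedAddCommGroup E] [NormedSpace ℝ E]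
    [FiniteDimensional ℝ E] [NormedAddCommGroup F] [NormedSpace ℝ F] [FiniteDimensional ℝ F]
    [Nontrivial F] [MeasurableSpace F] [BorelSpace F] (μ : Measure F) [μ.IsAddHaarMeasure]
    {U : Set E} (hU : IsOpen U) {f : E → F} (hf : ContDiffOn ℝ ∞ f U)
    (ih : ∀ K : Submodule ℝ E, Module.finrank ℝ K < Module.finrank ℝ E →
      ∀ (V : Set K) (g : K → F), IsOpen V → ContDiffOn ℝ ∞ g V →
        μ (g '' {y | y ∈ V ∧ ¬ Function.Surjective (fderiv ℝ g y)}) = 0) (k : ℕ) :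
    μ (f '' {x | x ∈ U ∧ fderiv ℝ f x = 0 ∧ iteratedFDeriv ℝ k f x = 0 ∧
      iteratedFDeriv ℝ (k + 1) f x ≠ 0}) = 0 := by
  refine measure_image_null_of_locally_null μ f fun x hx => ?_
  obtain ⟨hxU, hdx, hkx, hkx'⟩ := hx
  obtain ⟨m, hm⟩ : ∃ m, iteratedFDeriv ℝ (k + 1) f x m ≠ 0 := by
    by_contra! h
    exact hkx' (ContinuousMultilinearMap.ext h)
  obtain ⟨l, hl⟩ : ∃ l : F →L[ℝ] ℝ, l (iteratedFDeriv ℝ (k + 1) f x m) ≠ 0 := by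
    obtain ⟨l, _, hl⟩ := exists_dual_vector ℝ _ (norm_ne_zero_iff.2 hm)
    exact ⟨l, by rw [hl]; simpa using hm⟩
  -- The scalar component `w` of the `k`-th derivative vanishes on the set, while its derivative at
  -- `x` in the direction `m 0` does not; near `x` the set lies in the hypersurface `w = 0`, of
  -- smaller dimension.
  let ev : (E [×k]→L[ℝ] F) →L[ℝ] ℝ :=
    l.comp (ContinuousMultilinearMap.apply ℝ (fun _ : Fin k => E) F (Fin.tail m))
  let w : E → ℝ := fun y => ev (iteratedFDeriv ℝ k f y)
  have hit : ContDiffOn ℝ ∞ (iteratedFDeriv ℝ k f) U := by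
    intro y hy
    exact ((hf.contDiffAt (hU.mem_nhds hy)).iteratedFDeriv_right (m := ∞) (i := k)
      (by norm_cast)).contDiffWithinAt
  have hw : ContDiffOn ℝ ∞ w U := ev.contDiff.comp_contDiffOn hit
  have hdw : fderiv ℝ w x ≠ 0 := by
    intro h
    have hd : HasFDerivAt w (ev.comp (fderiv ℝ (iteratedFDeriv ℝ k f) x)) x :=
      ev.hasFDerivAt.comp x
        ((hit.contDiffAt (hU.mem_nhds hxU)).differentiableAt (by simp)).hasFDerivAt
    rw [hd.fderiv] at h
    have := congrArg (fun T : E →L[ℝ] ℝ => T (m 0)) h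
    apply hl
    rw [iteratedFDeriv_succ_apply_left]
    exact this
  obtain ⟨K, hK, Ω, φ, hΩ, hφ, hφU, hφx, hwφ⟩ := exists_straightening hU hw hxU hdw
  refine ⟨φ '' Ω, hφx, ?_⟩
  have hi : ContDiff ℝ ∞ (fun y : K => ((0 : ℝ), y)) := contDiff_const.prodMk contDiff_id
  have hV : IsOpen ((fun y : K => ((0 : ℝ), y)) ⁻¹' Ω) := hΩ.preimage hi.continuous
  have hφi : ContDiffOn ℝ ∞ (fun y : K => φ (0, y)) ((fun y : K => ((0 : ℝ), y)) ⁻¹' Ω) :=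
    hφ.comp hi.contDiffOn fun y hy => hy
  refine measure_mono_null ?_ (ih K hK _ (fun y => f (φ (0, y))) hV
    (hf.comp hφi fun y hy => hφU hy))
  rintro _ ⟨_, ⟨⟨hyU, hdy, hky, -⟩, ⟨t, y⟩, hp, rfl⟩, rfl⟩
  have ht : t = 0 := by
    have h1 : w (φ (t, y)) = t := hwφ _ hp
    rw [← h1]
    show ev (iteratedFDeriv ℝ k f (φ (t, y))) = 0
    rw [hky, map_zero]
  subst ht
  refine ⟨y, ⟨hp, ?_⟩, rfl⟩
  have h1 : HasFDerivAt f (0 : E →L[ℝ] F) (φ (0, y)) := by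
    rw [← hdy]
    exact ((hf.contDiffAt (hU.mem_nhds hyU)).differentiableAt (by simp)).hasFDerivAt
  have h2 := ((hφi.contDiffAt (hV.mem_nhds hp)).differentiableAt (by simp)).hasFDerivAt
  have h3 := (h1.comp y h2).fderiv
  rw [ContinuousLinearMap.zero_comp] at h3
  intro hs
  obtain ⟨z, hz⟩ := exists_ne (0 : F)
  obtain ⟨v, hv⟩ := hs z
  apply hz
  rw [← hv]
  exact congrArg (fun T : K →L[ℝ] F => T v) h3

/-- The inductive step in Sard's theorem at the critical points where the first derivative does not
vanish. -/
theorem addHaar_image_fderiv_ne_zero_eq_zero {E F : Type u} [NormedAddCommGroup E]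
    [NormedSpace ℝ E] [FiniteDimensional ℝ E] [NormedAddCommGroup F] [NormedSpace ℝ F]
    [FiniteDimensional ℝ F] [MeasurableSpace F] [BorelSpace F] (μ : Measure F)
    [μ.IsAddHaarMeasure] {U : Set E} (hU : IsOpen U) {f : E → F} (hf : ContDiffOn ℝ ∞ f U)
    (ih : ∀ K : Submodule ℝ E, Module.finrank ℝ K < Module.finrank ℝ E → ∀ (G : Submodule ℝ F),
      ∀ (V : Set K) (g : K → G), IsOpen V → ContDiffOn ℝ ∞ g V →
        (Measure.addHaar : Measure G)
          (g '' {y | y ∈ V ∧ ¬ Function.Surjective (fderiv ℝ g y)}) = 0) :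
    μ (f '' {x | (x ∈ U ∧ ¬ Function.Surjective (fderiv ℝ f x)) ∧ fderiv ℝ f x ≠ 0}) = 0 := by
  refine measure_image_null_of_locally_null μ f fun x hx => ?_
  obtain ⟨⟨hxU, -⟩, hdx⟩ := hx
  obtain ⟨v, hv⟩ : ∃ v, fderiv ℝ f x v ≠ 0 := by
    by_contra! h
    exact hdx (ContinuousLinearMap.ext h)
  obtain ⟨l, hl⟩ : ∃ l : F →L[ℝ] ℝ, l (fderiv ℝ f x v) ≠ 0 := by
    obtain ⟨l, _, hl⟩ := exists_dual_vector ℝ _ (norm_ne_zero_iff.2 hv)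
    exact ⟨l, by rw [hl]; simpa using hv⟩
  have hls : Function.Surjective l := LinearMap.surjective (f := l.toLinearMap) (by
    intro h
    exact hl (by simpa using congrArg (fun T : F →ₗ[ℝ] ℝ => T (fderiv ℝ f x v)) h))
  obtain ⟨R, hR⟩ := l.exists_rightInverse_of_surjective (LinearMap.range_eq_top.2 hls)
  let e : F ≃L[ℝ] ℝ × l.ker := ContinuousLinearEquiv.equivOfRightInverse l R
    (fun t => congrArg (fun T : ℝ →L[ℝ] ℝ => T t) hR)
  let w : E → ℝ := fun y => l (f y)
  have hw : ContDiffOn ℝ ∞ w U := l.contDiff.comp_contDiffOn hf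
  have hdw : fderiv ℝ w x ≠ 0 := by
    intro h
    have hd : HasFDerivAt w (l.comp (fderiv ℝ f x)) x := l.hasFDerivAt.comp x
      ((hf.contDiffAt (hU.mem_nhds hxU)).differentiableAt (by simp)).hasFDerivAt
    rw [hd.fderiv] at h
    exact hl (congrArg (fun T : E →L[ℝ] ℝ => T v) h)
  obtain ⟨K, hK, Ω, φ, hΩ, hφ, hφU, hφx, hwφ⟩ := exists_straightening hU hw hxU hdw
  -- Compactness of `Q` makes the image of the critical points in `Q` compact, hence measurable, so
  -- that Fubini applies to its slices.
  obtain ⟨Q, hQx, hQφ, hQ⟩ := local_compact_nhds (Filter.inter_mem hφx (hU.mem_nhds hxU))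
  refine ⟨Q, hQx, ?_⟩
  set C := {x | x ∈ U ∧ ¬ Function.Surjective (fderiv ℝ f x)} with hC
  have hCQ : IsCompact (C ∩ Q) := by
    have h1 : IsClosed (Q ∩ fderiv ℝ f ⁻¹' {L : E →L[ℝ] F | Function.Surjective L}ᶜ) :=
      ((hf.continuousOn_fderiv_of_isOpen hU (by simp)).mono
        fun y hy => (hQφ hy).2).preimage_isClosed_of_isClosed hQ.isClosed
        isOpen_setOf_surjective_continuousLinearMap.isClosed_compl
    have h2 : C ∩ Q = Q ∩ fderiv ℝ f ⁻¹' {L : E →L[ℝ] F | Function.Surjective L}ᶜ := by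
      ext y
      exact ⟨fun h => ⟨h.2, h.1.2⟩, fun h => ⟨⟨(hQφ h.1).2, h.2⟩, h.1⟩⟩
    rw [h2]
    exact hQ.of_isClosed_subset h1 inter_subset_left
  have hfQ : IsCompact (f '' (C ∩ Q)) :=
    hCQ.image_of_continuousOn (hf.continuousOn.mono fun y hy => hy.1.1)
  refine measure_mono_null (image_mono (t := C ∩ Q) fun y hy => ⟨hy.1.1, hy.2⟩) ?_
  have he : f '' (C ∩ Q) = e ⁻¹' (e '' (f '' (C ∩ Q))) := (e.injective.preimage_image _).symm
  rw [he, addHaar_preimage_null_iff μ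
    ((volume : Measure ℝ).prod (Measure.addHaar : Measure l.ker)) e,
    Measure.measure_prod_null (hfQ.image e.continuous).measurableSet]
  refine Filter.Eventually.of_forall fun t => ?_
  have hi : ContDiff ℝ ∞ (fun y : K => (t, y)) := contDiff_const.prodMk contDiff_id
  have hV : IsOpen ((fun y : K => (t, y)) ⁻¹' Ω) := hΩ.preimage hi.continuous
  have hG : ContDiffOn ℝ ∞ (fun p => f (φ p)) Ω := hf.comp hφ fun y hy => hφU hy
  let pr : F →L[ℝ] l.ker := (ContinuousLinearMap.snd ℝ ℝ l.ker).comp (e : F →L[ℝ] ℝ × l.ker)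
  have hg : ContDiffOn ℝ ∞ (fun y : K => pr (f (φ (t, y)))) ((fun y : K => (t, y)) ⁻¹' Ω) :=
    pr.contDiff.comp_contDiffOn (hG.comp hi.contDiffOn fun y hy => hy)
  refine measure_mono_null ?_ (ih K hK l.ker _ _ hV hg)
  rintro z ⟨_, ⟨y, ⟨⟨hyU, hys⟩, hyQ⟩, rfl⟩, hyz⟩
  obtain ⟨⟨⟨t', y'⟩, hp, rfl⟩, -⟩ := hQφ hyQ
  have ht : t' = t := by
    have h1 : w (φ (t', y')) = t' := hwφ _ hp
    rw [← h1]
    exact congrArg Prod.fst hyz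
  subst ht
  refine ⟨y', ⟨hp, fun hs => hys ?_⟩, congrArg Prod.snd hyz⟩
  have hdf := ((hf.contDiffAt (hU.mem_nhds hyU)).differentiableAt (by simp)).hasFDerivAt
  have hdφ := ((hφ.contDiffAt (hΩ.mem_nhds hp)).differentiableAt (by simp)).hasFDerivAt
  have hdG := hdf.comp (t', y') hdφ
  have hdi : HasFDerivAt (fun y : K => (t', y)) (ContinuousLinearMap.inr ℝ ℝ K) y' :=
    hasFDerivAt_prodMk_right t' y'
  have hdg := (pr.hasFDerivAt.comp y' (HasFDerivAt.comp (f := fun y : K => (t', y)) y' hdG hdi)).fderiv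
  have hdl : (l.comp ((fderiv ℝ f (φ (t', y'))).comp (fderiv ℝ φ (t', y')))) =
      ContinuousLinearMap.fst ℝ ℝ K := by
    have h1 := l.hasFDerivAt.comp (t', y') hdG
    refine h1.unique ((hasFDerivAt_fst (𝕜 := ℝ)).congr_of_eventuallyEq ?_)
    filter_upwards [hΩ.mem_nhds hp] with p hp
    exact hwφ p hp
  set D := (fderiv ℝ f (φ (t', y'))).comp (fderiv ℝ φ (t', y')) with hD
  -- In the coordinates `e`, the first component of `D` is the projection to `ℝ`, so `D` is block
  -- triangular; surjectivity on the slice therefore gives surjectivity of `D`.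
  have hDs : Function.Surjective D := by
    intro z
    obtain ⟨η, hη⟩ := hs (pr (z - D (l z, 0)))
    refine ⟨(l z, η), ?_⟩
    apply e.injective
    refine Prod.ext ?_ ?_
    · exact congrArg (fun T : ℝ × K →L[ℝ] ℝ => T (l z, η)) hdl
    · have h1 : pr (D (0, η)) = pr (z - D (l z, 0)) := by
        rw [← hη]
        exact (congrArg (fun T : K →L[ℝ] l.ker => T η) hdg).symm
      have h2 : D (l z, η) = D (l z, 0) + D (0, η) := by rw [← map_add]; simp
      show pr (D (l z, η)) = pr z
      rw [h2, map_add, h1, map_sub]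
      abel
  intro z
  obtain ⟨p, hp⟩ := hDs z
  exact ⟨_, hp⟩

/-- **Sard's theorem**: the set of critical values of a smooth map between finite-dimensional spaces
is null. -/
theorem addHaar_image_not_surjective_fderiv_eq_zero {E F : Type u} [NormedAddCommGroup E]
    [NormedSpace ℝ E] [FiniteDimensional ℝ E] [NormedAddCommGroup F] [NormedSpace ℝ F]
    [FiniteDimensional ℝ F] [MeasurableSpace F] [BorelSpace F] (μ : Measure F)
    [μ.IsAddHaarMeasure] {U : Set E} (hU : IsOpen U) {f : E → F} (hf : ContDiffOn ℝ ∞ f U) :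
    μ (f '' {x | x ∈ U ∧ ¬ Function.Surjective (fderiv ℝ f x)}) = 0 := by
  -- The target varies too, since slicing replaces `F` by a hyperplane.
  induction hn : Module.finrank ℝ E using Nat.strong_induction_on generalizing E F with
  | _ n ih =>
  subst hn
  rcases subsingleton_or_nontrivial F with hF | hF
  · have : {x | x ∈ U ∧ ¬ Function.Surjective (fderiv ℝ f x)} = ∅ :=
      eq_empty_of_forall_notMem fun x hx => hx.2 fun y => ⟨0, Subsingleton.elim _ _⟩
    rw [this, image_empty, measure_empty]
  refine measure_mono_null (t := f '' {x | (x ∈ U ∧ ¬ Function.Surjective (fderiv ℝ f x)) ∧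
      fderiv ℝ f x ≠ 0} ∪ ((⋃ k, f '' {x | x ∈ U ∧ fderiv ℝ f x = 0 ∧ iteratedFDeriv ℝ k f x = 0 ∧
      iteratedFDeriv ℝ (k + 1) f x ≠ 0}) ∪ f '' {x | x ∈ U ∧ ∀ j, 1 ≤ j →
        j ≤ Module.finrank ℝ E → iteratedFDeriv ℝ j f x = 0})) ?_ ?_
  · rintro _ ⟨x, hx, rfl⟩
    by_cases h1 : fderiv ℝ f x = 0
    · right
      by_cases h2 : ∀ j, 1 ≤ j → iteratedFDeriv ℝ j f x = 0
      · exact Or.inr ⟨x, ⟨hx.1, fun j hj _ => h2 j hj⟩, rfl⟩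
      · left
        push Not at h2
        have hz : iteratedFDeriv ℝ 1 f x = 0 := by
          rw [← norm_eq_zero, ← norm_iteratedFDeriv_fderiv, norm_iteratedFDeriv_zero, h1, norm_zero]
        classical
        obtain ⟨hj1, hj⟩ := Nat.find_spec h2
        have hmin := fun k => Nat.find_min h2 (m := k)
        set j := Nat.find h2
        -- The first nonvanishing order `j` is at least two, so the derivative of order `k = j - 1 ≥
        -- 1` vanishes by minimality.
        have hj2 : j ≠ 1 := fun h => hj (by rw [h]; exact hz)
        obtain ⟨k, hk⟩ : ∃ k, j = k + 1 := ⟨j - 1, by omega⟩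
        refine mem_iUnion.2 ⟨k, x, ⟨hx.1, h1, ?_, by rw [← hk]; exact hj⟩, rfl⟩
        by_contra h
        exact hmin k (by omega) ⟨by omega, h⟩
    · exact Or.inl ⟨x, ⟨hx, h1⟩, rfl⟩
  · refine measure_union_null ?_ (measure_union_null (measure_iUnion_null fun k => ?_) ?_)
    · exact addHaar_image_fderiv_ne_zero_eq_zero μ hU hf
        fun K hK G V g hV hg => ih _ hK (E := K) (F := G) _ hV hg rfl
    · exact addHaar_image_finite_order_eq_zero μ hU hf
        (fun K hK V g hV hg => ih _ hK (E := K) μ hV hg rfl) k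
    · exact addHaar_image_flat_eq_zero μ hU hf

end Sard

/-! ### Parametric transversality. -/

section Parametric

universe u

/-- Parametric transversality for families that are affine in the parameter: for almost every
parameter `π`, zero is a regular value of `v ↦ b v + A v π` at the points where `A v` is
surjective. -/
theorem addHaar_setOf_affine_not_transverse_eq_zero {E L W : Type u} [NormedAddCommGroup E]
    [NormedSpace ℝ E] [FiniteDimensional ℝ E] [NormedAddCommGroup L] [NormedSpace ℝ L]
    [FiniteDimensional ℝ L] [MeasurableSpace L] [BorelSpace L] [NormedAddCommGroup W]
    [NormedSpace ℝ W] [FiniteDimensional ℝ W] (μ : Measure L) [μ.IsAddHaarMeasure] {V : Set E}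
    (hV : IsOpen V) {b : E → W} (hb : ContDiffOn ℝ ∞ b V) {A : E → L →L[ℝ] W}
    (hA : ContDiffOn ℝ ∞ A V) :
    μ {π | ∃ u ∈ V, Function.Surjective (A u) ∧ b u + A u π = 0 ∧
      ¬ Function.Surjective (fderiv ℝ (fun v => b v + A v π) u)} = 0 := by
  have : CompleteSpace W := FiniteDimensional.complete ℝ W
  set P : E → Set L := fun u => {π | b u + A u π = 0 ∧
    ¬ Function.Surjective (fderiv ℝ (fun v => b v + A v π) u)} with hP
  suffices h : μ (⋃ u ∈ {u | u ∈ V ∧ Function.Surjective (A u)}, P u) = 0 by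
    refine measure_mono_null ?_ h
    rintro π ⟨u, hu, hs, h1⟩
    exact mem_iUnion₂.2 ⟨u, ⟨hu, hs⟩, h1⟩
  refine measure_biUnion_null_of_locally_null μ P fun x hx => ?_
  obtain ⟨R, hR⟩ := (A x).exists_rightInverse_of_surjective (LinearMap.range_eq_top.2 hx.2)
  have hAR : ContDiffOn ℝ ∞ (fun u => (A u).comp R) V :=
    ((ContinuousLinearMap.compL ℝ W L W).flip R).contDiff.comp_contDiffOn hA
  let V' : Set E := V ∩ (fun u => (A u).comp R) ⁻¹' {T | IsUnit T}
  have hV' : IsOpen V' := hAR.continuousOn.isOpen_inter_preimage hV Units.isOpen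
  have hxV' : x ∈ V' := ⟨hx.1, by simp only [mem_preimage, hR]; exact isUnit_one⟩
  refine ⟨V', hV'.mem_nhds hxV', ?_⟩
  let H : E × L → W := fun p => b p.1 + A p.1 p.2
  let Ω : Set (E × L) := Prod.fst ⁻¹' V'
  have hΩ : IsOpen Ω := hV'.preimage continuous_fst
  have hΩV : MapsTo Prod.fst Ω V := fun p hp => hp.1
  have hH : ContDiffOn ℝ ∞ H (Prod.fst ⁻¹' V) :=
    (hb.comp contDiff_fst.contDiffOn fun p hp => hp).add
      ((hA.comp contDiff_fst.contDiffOn fun p hp => hp).clm_apply contDiff_snd.contDiffOn)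
  let Θ : E × L → L := fun p => p.2 - R (Ring.inverse ((A p.1).comp R) (H p))
  have hinv : ContDiffOn ℝ ∞ (fun p : E × L => Ring.inverse ((A p.1).comp R)) Ω := by
    intro p hp
    obtain ⟨T, hT⟩ := hp.2
    have h1 : ContDiffAt ℝ ∞ (Ring.inverse : (W →L[ℝ] W) → W →L[ℝ] W) ((A p.1).comp R) := by
      have := contDiffAt_ringInverse ℝ T (n := ∞)
      rwa [hT] at this
    exact h1.comp_contDiffWithinAt p ((hAR.comp contDiff_fst.contDiffOn hΩV) p hp)
  have hΘ : ContDiffOn ℝ ∞ Θ Ω := contDiff_snd.contDiffOn.sub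
    (R.contDiff.comp_contDiffOn (hinv.clm_apply (hH.mono fun p hp => hp.1)))
  have hHΘ : ∀ p ∈ Ω, H (p.1, Θ p) = 0 := by
    intro p hp
    have h1 : (((A p.1).comp R) * Ring.inverse ((A p.1).comp R)) (H p) = H p := by
      rw [Ring.mul_inverse_cancel _ hp.2]; rfl
    have h2 : A p.1 (R (Ring.inverse ((A p.1).comp R) (H p))) = H p := h1
    show b p.1 + A p.1 (p.2 - R (Ring.inverse ((A p.1).comp R) (H p))) = 0
    rw [map_sub, h2, ← add_sub_assoc]
    exact sub_self _
  refine measure_mono_null ?_ (addHaar_image_not_surjective_fderiv_eq_zero μ hΩ hΘ)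
  intro π hπ
  obtain ⟨u, ⟨⟨huV, hus⟩, huV'⟩, hu0, hun⟩ := mem_iUnion₂.1 hπ
  have hp : (u, π) ∈ Ω := huV'
  have hΘπ : Θ (u, π) = π := by
    show π - R (Ring.inverse ((A u).comp R) (b u + A u π)) = π
    rw [hu0, map_zero, map_zero, sub_zero]
  refine ⟨(u, π), ⟨hp, fun hs => hun ?_⟩, hΘπ⟩
  have hdΘ := ((hΘ.contDiffAt (hΩ.mem_nhds hp)).differentiableAt (by simp)).hasFDerivAt
  set D := fderiv ℝ Θ (u, π) with hD
  have hdH : HasFDerivAt H (fderiv ℝ H (u, π)) (u, π) :=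
    ((hH.contDiffAt ((hV.preimage continuous_fst).mem_nhds huV)).differentiableAt
      (by simp)).hasFDerivAt
  have h1 : fderiv ℝ (fun v => b v + A v π) u =
      (fderiv ℝ H (u, π)).comp (ContinuousLinearMap.inl ℝ E L) :=
    (hdH.comp (f := fun v => (v, π)) u (hasFDerivAt_prodMk_left u π)).fderiv
  have h2 : A u = (fderiv ℝ H (u, π)).comp (ContinuousLinearMap.inr ℝ E L) :=
    ((A u).hasFDerivAt.const_add (b u)).unique
      (hdH.comp (f := fun ρ => (u, ρ)) π (hasFDerivAt_prodMk_right u π))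
  have h3 : (fderiv ℝ H (u, π)).comp ((ContinuousLinearMap.fst ℝ E L).prod D) = 0 := by
    have h4 : HasFDerivAt (fun p : E × L => (p.1, Θ p)) ((ContinuousLinearMap.fst ℝ E L).prod D)
      (u, π) := hasFDerivAt_fst.prodMk hdΘ
    have hdH' : HasFDerivAt H (fderiv ℝ H (u, π)) (u, Θ (u, π)) := by rwa [hΘπ]
    refine (HasFDerivAt.comp (u, π) hdH' h4).unique ?_
    refine (hasFDerivAt_const (0 : W) (u, π)).congr_of_eventuallyEq ?_
    filter_upwards [hΩ.mem_nhds hp] with p hp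
    exact hHΘ p hp
  intro z
  -- The derivative of `H` kills `(a, D (a, κ)) = (a, ρ)` and sends `(0, ρ)` to `-z`, so it sends
  -- `(a, 0)` to `z`.
  obtain ⟨ρ, hρ⟩ := hus (-z)
  obtain ⟨⟨a, κ⟩, haκ⟩ := hs ρ
  refine ⟨a, ?_⟩
  rw [h1]
  have h5 : fderiv ℝ H (u, π) (a, D (a, κ)) = 0 :=
    congrArg (fun T : E × L →L[ℝ] W => T (a, κ)) h3
  have h6 : fderiv ℝ H (u, π) (0, ρ) = -z := by
    rw [← hρ, h2]; rfl
  have h7 : ((a, D (a, κ)) : E × L) = (a, 0) + (0, ρ) := by rw [haκ]; simp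
  rw [h7, map_add, h6, add_neg_eq_zero] at h5
  exact h5

end Parametric

/-! ### Evaluation on independent vectors, and general position. -/

section GeneralPosition

/-- The map sending `π` to its values on a tuple of vectors, as a function of the tuple. -/
noncomputable def evalTuple (r : ℕ) (V W : Type*) [NormedAddCommGroup V] [NormedSpace ℝ V]
    [NormedAddCommGroup W] [NormedSpace ℝ W] :
    (Fin r → V) →L[ℝ] (V →L[ℝ] W) →L[ℝ] (Fin r → W) :=
  ∑ i, ((ContinuousLinearMap.compL ℝ (V →L[ℝ] W) W (Fin r → W)
    (ContinuousLinearMap.single ℝ (fun _ : Fin r => W) i)).comp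
      (ContinuousLinearMap.apply ℝ W)).comp (ContinuousLinearMap.proj i)

theorem evalTuple_apply {r : ℕ} {V W : Type*} [NormedAddCommGroup V] [NormedSpace ℝ V]
    [NormedAddCommGroup W] [NormedSpace ℝ W] (v : Fin r → V) (π : V →L[ℝ] W) (i : Fin r) :
    evalTuple r V W v π i = π (v i) := by
  simp [evalTuple, Finset.sum_apply, Pi.single_apply]

/-- Values on independent vectors can be prescribed freely and extended linearly to the whole space.
-/
theorem evalTuple_surjective_of_linearIndependent {r : ℕ} {V W : Type*} [NormedAddCommGroup V]
    [NormedSpace ℝ V] [FiniteDimensional ℝ V] [NormedAddCommGroup W] [NormedSpace ℝ W]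
    {v : Fin r → V} (hv : LinearIndependent ℝ v) : Function.Surjective (evalTuple r V W v) := by
  intro w
  obtain ⟨g, hg⟩ := LinearMap.exists_extend
    ((Finsupp.linearCombination ℝ w).comp hv.repr)
  refine ⟨LinearMap.toContinuousLinearMap g, funext fun i => ?_⟩
  rw [evalTuple_apply]
  have hi : v i ∈ Submodule.span ℝ (range v) := Submodule.subset_span (mem_range_self i)
  have h1 := congrArg (fun T : Submodule.span ℝ (range v) →ₗ[ℝ] W => T ⟨v i, hi⟩) hg
  have h2 : hv.repr ⟨v i, hi⟩ = Finsupp.single i 1 := hv.repr_eq_single i _ rfl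
  simpa [h2] using h1

/-- The definition of `s_f` constrains tuples of length exactly `s_f`; padding a shorter tuple with
new points lets it inherit independence. -/
theorem exists_injective_extension {N : Type*} [Infinite N] {r k : ℕ} (hrk : r ≤ k)
    {q : Fin r → N} (hq : Function.Injective q) :
    ∃ q' : Fin k → N, Function.Injective q' ∧ ∀ i, q' (Fin.castLE hrk i) = q i := by
  have : Infinite ↥(range q)ᶜ := (finite_range q).infinite_compl.to_subtype
  let e := Infinite.natEmbedding ↥(range q)ᶜ
  have he : ∀ a i, (e a : N) ≠ q i := fun a i h => (e a).2 ⟨i, h.symm⟩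
  refine ⟨fun i => if h : i.1 < r then q ⟨i, h⟩ else e i, ?_, fun i => by simp⟩
  intro i j hij
  by_cases hi : i.1 < r <;> by_cases hj : j.1 < r <;> simp only [hi, hj, dite_true, dite_false] at hij
  · exact Fin.ext (Fin.mk.inj_iff.1 (hq hij))
  · exact (he _ _ hij.symm).elim
  · exact (he _ _ hij).elim
  · exact Fin.ext (e.injective (Subtype.ext hij))

/-- Any `r + 1 ≤ s_f` distinct points have affinely independent images. -/
theorem linearIndependent_of_le_generalPositionIndex {N V : Type*} [Infinite N] [AddCommGroup V]
    [Module ℝ V] [FiniteDimensional ℝ V] (f : N → V) {r : ℕ} (hr : r + 1 ≤ generalPositionIndex f)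
    {q : Fin (r + 1) → N} (hq : Function.Injective q) :
    LinearIndependent ℝ fun i : Fin r => f (q i.succ) - f (q 0) := by
  have hmem := (isGreatest_generalPositionIndex f).1
  obtain ⟨k, hk⟩ : ∃ k, generalPositionIndex f = k + 1 :=
    ⟨generalPositionIndex f - 1, by omega⟩
  rw [hk] at hmem hr
  obtain ⟨q', hq', hqq'⟩ := exists_injective_extension hr hq
  obtain ⟨hs, h⟩ := hmem
  have h1 := h q' fun i j hij hh => hij (hq' hh)
  have h2 : {v : V | ∃ i : Fin (k + 1), i ≠ ⟨0, hs⟩ ∧ v = f (q' i) - f (q' ⟨0, hs⟩)} =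
      range fun i : Fin k => f (q' i.succ) - f (q' 0) := by
    ext v
    constructor
    · rintro ⟨i, hi, rfl⟩
      obtain ⟨j, rfl⟩ := Fin.exists_succ_eq.2 hi
      exact ⟨j, rfl⟩
    · rintro ⟨j, rfl⟩
      exact ⟨j.succ, Fin.succ_ne_zero j, rfl⟩
  rw [h2] at h1
  have h3 : LinearIndependent ℝ fun i : Fin k => f (q' i.succ) - f (q' 0) := by
    rw [linearIndependent_iff_card_eq_finrank_span, Set.finrank, h1]
    simp
  have hrk : r ≤ k := by omega
  have h4 := h3.comp (Fin.castLE hrk) (Fin.castLE_injective hrk)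
  convert h4 using 1
  funext i
  have e1 := hqq' i.succ
  have e0 := hqq' 0
  rw [← e1, ← e0]
  rfl

end GeneralPosition

/-! ### Null sets of linear maps and of matrices. -/

section Representing

/-- The identification of linear mappings with matrices. -/
noncomputable def representingMatrixEquiv (m ℓ : ℕ) :
    (EuclideanSpace ℝ (Fin m) →L[ℝ] EuclideanSpace ℝ (Fin ℓ)) ≃L[ℝ] (Fin ℓ → Fin m → ℝ) :=
  ((LinearMap.toContinuousLinearMap (𝕜 := ℝ) (E := EuclideanSpace ℝ (Fin m))
    (F' := EuclideanSpace ℝ (Fin ℓ))).symm.trans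
    ((LinearMap.toMatrix (EuclideanSpace.basisFun (Fin m) ℝ).toBasis
      (EuclideanSpace.basisFun (Fin ℓ) ℝ).toBasis).trans
        (Matrix.ofLinearEquiv ℝ).symm)).toContinuousLinearEquiv

theorem representingMatrixEquiv_toContinuousLinearMap {m ℓ : ℕ}
    (π : EuclideanSpace ℝ (Fin m) →ₗ[ℝ] EuclideanSpace ℝ (Fin ℓ)) :
    representingMatrixEquiv m ℓ (LinearMap.toContinuousLinearMap π) = representingMatrix π := by
  ext i j
  simp [representingMatrixEquiv, representingMatrix, LinearMap.toMatrix_apply]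

theorem lebesgueNull_of_addHaar_null {m ℓ : ℕ}
    {T : Set (EuclideanSpace ℝ (Fin m) →L[ℝ] EuclideanSpace ℝ (Fin ℓ))}
    (hT : (Measure.addHaar : Measure (EuclideanSpace ℝ (Fin m) →L[ℝ] EuclideanSpace ℝ (Fin ℓ))) T
      = 0) : LebesgueNull {π : EuclideanSpace ℝ (Fin m) →ₗ[ℝ] EuclideanSpace ℝ (Fin ℓ) |
        LinearMap.toContinuousLinearMap π ∈ T} := by
  refine measure_mono_null ?_ ((addHaar_preimage_null_iff volume Measure.addHaar
    (representingMatrixEquiv m ℓ).symm T).2 hT)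
  rintro _ ⟨π, hπ, rfl⟩
  rw [← representingMatrixEquiv_toContinuousLinearMap]
  simpa using hπ

end Representing

/-! ### Infinitude of manifolds of positive dimension. -/

section Manifold

variable {n : ℕ} {N : Type*} [TopologicalSpace N] [ChartedSpace (EuclideanSpace ℝ (Fin n)) N]

/-- A chart target is a nonempty open subset of `ℝ^n`. Infinitude of `N` makes the supremum defining
`s_f` an attained maximum. -/
theorem infinite_of_chartedSpace (hn : 0 < n) [Nonempty N] : Infinite N := by
  obtain ⟨q⟩ := ‹Nonempty N›
  have : Nonempty (Fin n) := ⟨⟨0, hn⟩⟩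
  have h : (chartAt (EuclideanSpace ℝ (Fin n)) q).target.Infinite :=
    infinite_of_mem_nhds _ (chart_target_mem_nhds (EuclideanSpace ℝ (Fin n)) q)
  rw [← (chartAt (EuclideanSpace ℝ (Fin n)) q).image_source_eq_target] at h
  exact infinite_univ_iff.1 (h.of_image.mono (subset_univ _))


end Manifold

/-! ### Transversality to the diagonal via differences. -/

section Transversality

variable {n : ℕ} {N : Type*} [TopologicalSpace N] [ChartedSpace (EuclideanSpace ℝ (Fin n)) N]

/-- The chart of `N^(s)` at `q` is a restriction of the product of the charts at the `q_i`, so the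
derivative can be computed componentwise. -/
theorem hasMFDerivAt_multiMap [T2Space N] {E : Type*} [NormedAddCommGroup E] [NormedSpace ℝ E]
    {g : N → E} (hg : MDifferentiable (𝓡 n) 𝓘(ℝ, E) g) {s : ℕ} (q : configSpace N s)
    (D : Fin s → EuclideanSpace ℝ (Fin n) →L[ℝ] E)
    (hD : ∀ i, D i = mfderiv (𝓡 n) 𝓘(ℝ, E) g (q.1 i)) :
    HasMFDerivAt (ModelWithCorners.pi fun _ : Fin s => 𝓡 n) 𝓘(ℝ, Fin s → E) (multiMap g s) q
      (ContinuousLinearMap.pi fun i => (D i).comp (ContinuousLinearMap.proj i)) := by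
  refine ⟨(continuous_pi fun i => hg.continuous.comp
    ((continuous_apply i).comp continuous_subtype_val)).continuousAt, ?_⟩
  let u₀ : Fin s → EuclideanSpace ℝ (Fin n) := fun i =>
    chartAt (EuclideanSpace ℝ (Fin n)) (q.1 i) (q.1 i)
  have hi : ∀ i, HasFDerivAt (fun y : EuclideanSpace ℝ (Fin n) =>
      g ((chartAt (EuclideanSpace ℝ (Fin n)) (q.1 i)).symm y)) (D i) (u₀ i) := by
    intro i
    rw [← hasFDerivWithinAt_univ, ← (𝓡 n).range_eq_univ, hD]
    exact (hg (q.1 i)).hasMFDerivAt.2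
  have hpi : HasFDerivAt (fun (u : Fin s → EuclideanSpace ℝ (Fin n)) i =>
      g ((chartAt (EuclideanSpace ℝ (Fin n)) (q.1 i)).symm (u i)))
      (ContinuousLinearMap.pi fun i => (D i).comp (ContinuousLinearMap.proj i)) u₀ :=
    hasFDerivAt_pi.2 fun i => HasFDerivAt.comp
      (f := fun u : Fin s → EuclideanSpace ℝ (Fin n) => u i) u₀ (hi i) (hasFDerivAt_apply i u₀)
  have hev : (writtenInExtChartAt (ModelWithCorners.pi fun _ : Fin s => 𝓡 n) 𝓘(ℝ, Fin s → E) q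
      (multiMap g s)) =ᶠ[𝓝 u₀] fun u i =>
        g ((chartAt (EuclideanSpace ℝ (Fin n)) (q.1 i)).symm (u i)) := by
    let e := chartAt (ModelPi fun _ : Fin s => EuclideanSpace ℝ (Fin n)) q
    have ht : e.target ∈ 𝓝 u₀ := e.open_target.mem_nhds (mem_chart_target _ q)
    filter_upwards [ht] with u hu
    funext i
    have hne : Nonempty (configSpace N s) := ⟨q⟩
    have h1 := OpenPartialHomeomorph.subtypeRestr_symm_apply
      (e := chartAt (ModelPi fun _ : Fin s => EuclideanSpace ℝ (Fin n)) q.1) hne hu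
    exact congrArg (fun p : Fin s → N => g (p i)) h1
  have hfin := (hpi.congr_of_eventuallyEq hev).hasFDerivWithinAt
    (s := range (ModelWithCorners.pi fun _ : Fin s => 𝓡 n))
  exact hfin

/-- Transversality of a multi-map to the diagonal, in terms of the differences of the
components. -/
theorem transverse_diagonal_of_surjective [T2Space N] {E : Type*} [NormedAddCommGroup E]
    [NormedSpace ℝ E] {g : N → E} (hg : MDifferentiable (𝓡 n) 𝓘(ℝ, E) g) {r : ℕ}
    (q : configSpace N (r + 1)) (D : Fin (r + 1) → EuclideanSpace ℝ (Fin n) →L[ℝ] E)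
    (hD : ∀ i, D i = mfderiv (𝓡 n) 𝓘(ℝ, E) g (q.1 i))
    (hs : Function.Surjective fun (v : Fin (r + 1) → EuclideanSpace ℝ (Fin n)) (i : Fin r) =>
      D i.succ (v i.succ) - D 0 (v 0))
    (hq : multiMap g (r + 1) q ∈ diagonalSet E (r + 1)) :
    (LinearMap.range (mfderiv (ModelWithCorners.pi fun _ : Fin (r + 1) => 𝓡 n)
      𝓘(ℝ, Fin (r + 1) → E) (multiMap g (r + 1)) q).toLinearMap :
        Submodule ℝ (Fin (r + 1) → E)) ⊔
      submanifoldTangent (diagonalSet E (r + 1)) (multiMap g (r + 1) q) = ⊤ := by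
  rw [(hasMFDerivAt_multiMap hg q D hD).mfderiv]
  refine eq_top_iff.2 fun z _ => ?_
  -- With this `v`, all components of `z - (D i (v i))_i` agree; the remainder is the velocity of a
  -- straight line in the diagonal.
  obtain ⟨v, hv⟩ := hs fun i => z i.succ - z 0
  refine Submodule.mem_sup.2 ⟨fun i => D i (v i), ⟨v, rfl⟩, fun _ => z 0 - D 0 (v 0), ?_, ?_⟩
  · refine Submodule.subset_span ⟨fun t => multiMap g (r + 1) q + t • fun _ => z 0 - D 0 (v 0),
      ?_, by simp, Filter.Eventually.of_forall fun t => ?_, ?_⟩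
    · exact contDiffAt_const.add (contDiffAt_id.smul contDiffAt_const)
    · obtain ⟨y, hy⟩ := hq
      refine ⟨y + t • (z 0 - D 0 (v 0)), ?_⟩
      rw [hy]
      rfl
    · have := ((hasDerivAt_id (0 : ℝ)).smul_const
        (fun _ : Fin (r + 1) => z 0 - D 0 (v 0))).const_add (multiMap g (r + 1) q)
      simpa using this.deriv
  · funext i
    refine Fin.cases ?_ (fun j => ?_) i
    · simp
    · have := congrFun hv j
      simp only [Pi.add_apply]
      rw [sub_eq_sub_iff_add_eq_add] at this
      rw [← add_sub_assoc, this]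
      abel

end Transversality

/-! ### Passage to charts, and almost every perturbation. -/

section Charts

variable {n : ℕ} {N : Type*} [TopologicalSpace N] [ChartedSpace (EuclideanSpace ℝ (Fin n)) N]

/-- The differences `g (q_i) - g (q_0)` read in the charts at the points of the tuple `c`. -/
noncomputable def chartDifference {E : Type*} [Sub E] (g : N → E) {r : ℕ} (c : Fin (r + 1) → N)
    (u : Fin (r + 1) → EuclideanSpace ℝ (Fin n)) : Fin r → E := fun i =>
  g ((extChartAt (𝓡 n) (c i.succ)).symm (u i.succ)) - g ((extChartAt (𝓡 n) (c 0)).symm (u 0))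

variable (n) in
/-- The product of the targets of the charts at the points of the tuple `c`. -/
def chartTargets {r : ℕ} (c : Fin (r + 1) → N) : Set (Fin (r + 1) → EuclideanSpace ℝ (Fin n)) :=
  univ.pi fun i => (extChartAt (𝓡 n) (c i)).target

theorem isOpen_chartTargets {r : ℕ} (c : Fin (r + 1) → N) : IsOpen (chartTargets n c) :=
  isOpen_set_pi finite_univ fun i _ => isOpen_extChartAt_target (c i)

variable [IsManifold (𝓡 n) ∞ N]

theorem contDiffOn_chartDifference {E : Type*} [NormedAddCommGroup E] [NormedSpace ℝ E]
    {g : N → E} (hg : ContMDiff (𝓡 n) 𝓘(ℝ, E) ∞ g) {r : ℕ} (c : Fin (r + 1) → N) :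
    ContDiffOn ℝ ∞ (chartDifference g c) (chartTargets n c) := by
  have h : ∀ i, ContDiffOn ℝ ∞ (fun u : Fin (r + 1) → EuclideanSpace ℝ (Fin n) =>
      g ((extChartAt (𝓡 n) (c i)).symm (u i))) (chartTargets n c) := by
    intro i
    have h1 : ContDiffOn ℝ ∞ (fun y => g ((extChartAt (𝓡 n) (c i)).symm y))
        (extChartAt (𝓡 n) (c i)).target :=
      (hg.comp_contMDiffOn (contMDiffOn_extChartAt_symm (c i))).contDiffOn
    exact h1.comp (contDiff_apply ℝ _ i).contDiffOn fun u hu => hu i (mem_univ i)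
  exact contDiffOn_pi.2 fun i => (h i.succ).sub (h 0)

/-- If the chart expression of the differences is a submersion, so are the differences
themselves. -/
theorem surjective_difference_of_chartDifference {E : Type*} [NormedAddCommGroup E]
    [NormedSpace ℝ E] {g : N → E} (hg : ContMDiff (𝓡 n) 𝓘(ℝ, E) ∞ g) {r : ℕ}
    (c q : Fin (r + 1) → N) (hqc : ∀ i, q i ∈ (extChartAt (𝓡 n) (c i)).source)
    (D : Fin (r + 1) → EuclideanSpace ℝ (Fin n) →L[ℝ] E)
    (hD : ∀ i, D i = mfderiv (𝓡 n) 𝓘(ℝ, E) g (q i))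
    (hs : Function.Surjective
      (fderiv ℝ (chartDifference g c) fun i => extChartAt (𝓡 n) (c i) (q i))) :
    Function.Surjective fun (v : Fin (r + 1) → EuclideanSpace ℝ (Fin n)) (i : Fin r) =>
      D i.succ (v i.succ) - D 0 (v 0) := by
  set u₀ : Fin (r + 1) → EuclideanSpace ℝ (Fin n) := fun i => extChartAt (𝓡 n) (c i) (q i) with hu₀
  have hmem : ∀ i, u₀ i ∈ (extChartAt (𝓡 n) (c i)).target := fun i =>
    (extChartAt (𝓡 n) (c i)).map_source (hqc i)
  -- Only a factorization through `D i` is needed: the image under `D i ∘ T` lies in that under `D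
  -- i`, so invertibility of `T` plays no role.
  have hfac : ∀ i, ∃ T : EuclideanSpace ℝ (Fin n) →L[ℝ] EuclideanSpace ℝ (Fin n),
      HasFDerivAt (fun y => g ((extChartAt (𝓡 n) (c i)).symm y)) ((D i).comp T) (u₀ i) := by
    intro i
    have hσ : MDifferentiableAt (𝓡 n) (𝓡 n) (extChartAt (𝓡 n) (c i)).symm (u₀ i) :=
      ((contMDiffOn_extChartAt_symm (n := ∞) (c i)).contMDiffAt
        ((isOpen_extChartAt_target (c i)).mem_nhds (hmem i))).mdifferentiableAt (by simp)
    have hq : (extChartAt (𝓡 n) (c i)).symm (u₀ i) = q i :=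
      (extChartAt (𝓡 n) (c i)).left_inv (hqc i)
    have hgq : HasMFDerivAt (𝓡 n) 𝓘(ℝ, E) g ((extChartAt (𝓡 n) (c i)).symm (u₀ i)) (D i) := by
      rw [hq, hD]
      exact (hg.mdifferentiable (by simp) (q i)).hasMFDerivAt
    exact ⟨_, hasMFDerivAt_iff_hasFDerivAt.1 (hgq.comp (u₀ i) hσ.hasMFDerivAt)⟩
  choose T hT using hfac
  have hT' : ∀ i, HasFDerivAt (fun u : Fin (r + 1) → EuclideanSpace ℝ (Fin n) =>
      g ((extChartAt (𝓡 n) (c i)).symm (u i)))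
        (((D i).comp (T i)).comp (ContinuousLinearMap.proj i)) u₀ := fun i =>
    HasFDerivAt.comp (f := fun u : Fin (r + 1) → EuclideanSpace ℝ (Fin n) => u i) u₀ (hT i)
      (hasFDerivAt_apply i u₀)
  have hd : HasFDerivAt (chartDifference g c) (ContinuousLinearMap.pi fun i : Fin r =>
      ((D i.succ).comp (T i.succ)).comp (ContinuousLinearMap.proj i.succ) -
        ((D 0).comp (T 0)).comp (ContinuousLinearMap.proj 0)) u₀ :=
    hasFDerivAt_pi.2 fun i => (hT' i.succ).sub (hT' 0)
  intro z
  obtain ⟨v, hv⟩ := hs z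
  rw [hd.fderiv] at hv
  exact ⟨fun i => T i (v i), hv⟩

/-- For almost every linear perturbation `π` of `a`, along `φ`, the multi-maps of the perturbed
mapping are transverse to the diagonal wherever the points of the tuple have affinely independent
images under `φ`. -/
theorem addHaar_setOf_not_transverse_eq_zero [T2Space N] [SecondCountableTopology N] {V E : Type}
    [NormedAddCommGroup V] [NormedSpace ℝ V] [FiniteDimensional ℝ V] [NormedAddCommGroup E]
    [NormedSpace ℝ E] [FiniteDimensional ℝ E] [MeasurableSpace (V →L[ℝ] E)] [BorelSpace (V →L[ℝ] E)]
    (μ : Measure (V →L[ℝ] E)) [μ.IsAddHaarMeasure] {a : N → E} {φ : N → V}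
    (ha : ContMDiff (𝓡 n) 𝓘(ℝ, E) ∞ a) (hφ : ContMDiff (𝓡 n) 𝓘(ℝ, V) ∞ φ) (r : ℕ)
    (hli : ∀ q : configSpace N (r + 1),
      LinearIndependent ℝ fun i : Fin r => φ (q.1 i.succ) - φ (q.1 0)) :
    μ {π | ¬ TransverseTo (ModelWithCorners.pi fun _ : Fin (r + 1) => 𝓡 n)
      (multiMap (fun q => a q + π (φ q)) (r + 1)) (diagonalSet E (r + 1))} = 0 := by
  obtain ⟨t, htc, ht⟩ := TopologicalSpace.countable_cover_nhds
    (f := fun x : N => (extChartAt (𝓡 n) x).source) fun x => extChartAt_source_mem_nhds x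
  have htuple : (univ.pi fun _ : Fin (r + 1) => t).Countable := countable_univ_pi fun _ => htc
  -- Surjectivity of the evaluation takes the place of distinctness of the points, so `u` may range
  -- over the whole product of chart targets.
  let P : (Fin (r + 1) → N) → Set (V →L[ℝ] E) := fun c => {π | ∃ u ∈ chartTargets n c,
    Function.Surjective (evalTuple r V E (chartDifference φ c u)) ∧
    chartDifference a c u + evalTuple r V E (chartDifference φ c u) π = 0 ∧
    ¬ Function.Surjective (fderiv ℝ (fun v => chartDifference a c v +
      evalTuple r V E (chartDifference φ c v) π) u)}
  have hev : ContDiff ℝ ∞ fun v : Fin r → V => evalTuple r V E v :=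
    ContinuousLinearMap.contDiff (𝕜 := ℝ) (E := Fin r → V) (F := (V →L[ℝ] E) →L[ℝ] Fin r → E)
      (evalTuple r V E)
  have hP : ∀ c, μ (P c) = 0 := fun c =>
    addHaar_setOf_affine_not_transverse_eq_zero μ (isOpen_chartTargets c)
      (contDiffOn_chartDifference ha c)
      (hev.comp_contDiffOn (contDiffOn_chartDifference hφ c))
  refine measure_mono_null ?_ ((measure_biUnion_null_iff htuple).2 fun c _ => hP c)
  intro π hπ
  by_contra hnot
  refine hπ fun q hq => ?_
  have hgs : ContMDiff (𝓡 n) 𝓘(ℝ, E) ∞ (fun q => a q + π (φ q)) :=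
    ha.add (π.contMDiff.comp hφ)
  choose c hct hqc using fun i => mem_iUnion₂.1 (ht ▸ mem_univ (q.1 i))
  have hcd : ∀ v : Fin (r + 1) → EuclideanSpace ℝ (Fin n),
      chartDifference (fun q => a q + π (φ q)) c v =
        chartDifference a c v + evalTuple r V E (chartDifference φ c v) π := by
    intro v
    funext i
    rw [Pi.add_apply, evalTuple_apply]
    simp only [chartDifference, map_sub]
    abel
  have hval : ∀ (G : Type) [Sub G] (g : N → G),
      chartDifference g c (fun i => extChartAt (𝓡 n) (c i) (q.1 i)) =
        fun i : Fin r => g (q.1 i.succ) - g (q.1 0) := by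
    intro G _ g
    funext i
    simp only [chartDifference]
    rw [(extChartAt (𝓡 n) (c i.succ)).left_inv (hqc i.succ),
      (extChartAt (𝓡 n) (c 0)).left_inv (hqc 0)]
  refine transverse_diagonal_of_surjective (hgs.mdifferentiable (by simp)) q
    (fun i => mfderiv (𝓡 n) 𝓘(ℝ, E) (fun q => a q + π (φ q)) (q.1 i)) (fun i => rfl) ?_ hq
  refine surjective_difference_of_chartDifference hgs c q.1 hqc _ (fun i => rfl) ?_
  by_contra hns
  refine hnot (mem_iUnion₂.2 ⟨c, fun i _ => hct i,
    fun i => extChartAt (𝓡 n) (c i) (q.1 i), ?_, ?_, ?_, ?_⟩)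
  · exact fun i _ => (extChartAt (𝓡 n) (c i)).map_source (hqc i)
  · rw [hval]
    exact evalTuple_surjective_of_linearIndependent (hli q)
  · rw [← hcd, hval]
    obtain ⟨y, hy⟩ := hq
    funext i
    have h1 := congrFun hy i.succ
    have h0 := congrFun hy 0
    simp only [multiMap] at h1 h0
    rw [h1, h0, sub_self]
    rfl
  · simpa only [← hcd] using hns

end Charts

/-! ### The main theorem. -/

theorem theorem2p2 (n m ℓ : ℕ) (hn : 0 < n) (hm : 0 < m) (hℓ : 0 < ℓ)
    (N : Type*) [TopologicalSpace N] [T2Space N] [SecondCountableTopology N] [Nonempty N]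
    [ChartedSpace (EuclideanSpace ℝ (Fin n)) N] [IsManifold (𝓡 n) ∞ N]
    (U : TopologicalSpace.Opens (EuclideanSpace ℝ (Fin m)))
    (f : N → U) (hf : ContMDiff (𝓡 n) (𝓡 m) ∞ f) (hinj : Function.Injective f)
    (F : U → EuclideanSpace ℝ (Fin ℓ)) (hF : ContMDiff (𝓡 m) (𝓡 ℓ) ∞ F) :
    ∃ S : Set (EuclideanSpace ℝ (Fin m) →ₗ[ℝ] EuclideanSpace ℝ (Fin ℓ)),
      LebesgueNull S ∧
      ∀ π : EuclideanSpace ℝ (Fin m) →ₗ[ℝ] EuclideanSpace ℝ (Fin ℓ), π ∉ S →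
        (∀ s : ℕ, 2 ≤ s →
          s ≤ generalPositionIndex (fun q => (f q : EuclideanSpace ℝ (Fin m))) →
          MultiTransverse (n := n) (linearPerturbation F π ∘ f) s) ∧
        ((∀ y : EuclideanSpace ℝ (Fin ℓ), (linearPerturbation F π ⁻¹' {y}).encard ≤
            generalPositionIndex (fun q => (f q : EuclideanSpace ℝ (Fin m)))) →
          NormalCrossings (n := n) (linearPerturbation F π ∘ f)) := by
  have hN : Infinite N := infinite_of_chartedSpace hn
  set φ : N → EuclideanSpace ℝ (Fin m) := fun q => (f q : EuclideanSpace ℝ (Fin m)) with hφdef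
  have hφ : ContMDiff (𝓡 n) (𝓡 m) ∞ φ := contMDiff_subtype_val.comp hf
  have ha : ContMDiff (𝓡 n) (𝓡 ℓ) ∞ (F ∘ f) := hF.comp hf
  -- The bound on `r + 1` is part of the set, so `B r` is empty for larger `r` and the union over
  -- all `r` is null.
  let B : ℕ → Set (EuclideanSpace ℝ (Fin m) →L[ℝ] EuclideanSpace ℝ (Fin ℓ)) := fun r =>
    {π | r + 1 ≤ generalPositionIndex φ ∧
      ¬ MultiTransverse (n := n) (fun q => (F ∘ f) q + π (φ q)) (r + 1)}
  have hB : ∀ r, (Measure.addHaar : Measure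
      (EuclideanSpace ℝ (Fin m) →L[ℝ] EuclideanSpace ℝ (Fin ℓ))) (B r) = 0 := by
    intro r
    by_cases hr : r + 1 ≤ generalPositionIndex φ
    · refine measure_mono_null (fun π hπ => hπ.2)
        (addHaar_setOf_not_transverse_eq_zero Measure.addHaar ha hφ r fun q => ?_)
      refine linearIndependent_of_le_generalPositionIndex φ hr fun i j hij => ?_
      by_contra hne
      exact q.2 i j hne hij
    · exact measure_mono_null (fun π hπ => hr hπ.1) measure_empty
  have hsmall : ∀ π : EuclideanSpace ℝ (Fin m) →ₗ[ℝ] EuclideanSpace ℝ (Fin ℓ),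
      LinearMap.toContinuousLinearMap π ∉ ⋃ r, B r → ∀ s : ℕ, 2 ≤ s →
        s ≤ generalPositionIndex φ → MultiTransverse (n := n) (linearPerturbation F π ∘ f) s := by
    intro π hπ s hs hsf
    obtain ⟨r, rfl⟩ : ∃ r, s = r + 1 := ⟨s - 1, by omega⟩
    by_contra hnt
    exact hπ (mem_iUnion.2 ⟨r, hsf, hnt⟩)
  refine ⟨_, lebesgueNull_of_addHaar_null (measure_iUnion_null hB), fun π hπ =>
    ⟨hsmall π hπ, fun hfib s hs => ?_⟩⟩
  by_cases hsf : s ≤ generalPositionIndex φ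
  · exact hsmall π hπ s hs hsf
  -- Here `s > s_f`, and `q` would put `s` distinct points `f (q_i)` into the fibre over `y`.
  rintro q ⟨y, hy⟩
  have hqi : Function.Injective fun i => f (q.1 i) := by
    refine hinj.comp fun i j hij => ?_
    by_contra hne
    exact q.2 i j hne hij
  have hsub : range (fun i => f (q.1 i)) ⊆ linearPerturbation F π ⁻¹' {y} := by
    rintro _ ⟨i, rfl⟩
    exact congrFun hy i
  have hcard : ((s : ℕ) : ℕ∞) ≤ generalPositionIndex φ := by
    refine le_trans ?_ ((encard_le_encard hsub).trans (hfib y))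
    rw [← image_univ, hqi.encard_image, encard_univ]
    simp
  exact (hsf (by exact_mod_cast hcard)).elim
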